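/- Let $\Gamma$ be a finite graph with vertices $v_1,\dots,v_r$, and let $A_\Gamma$ be its right-angled Artin group: the group generated by $v_1,\dots,v_r$ subject to the relations $[v_i,v_j]=1$ for all adjacent $v_i,v_j$. Let $M_\Gamma$ be the monoid of positive words in $v_1,\dots,v_r$ modulo the congruence generated by $v_iv_j\sim v_jv_i$ whenever $[v_i,v_j]=1$ in $A_\Gamma$. Let $U_\Gamma$ be the associative $\mathbb{Z}$-algebra that is the free $\mathbb{Z}$-module on $M_\Gamma$ with the multiplication of $M_\Gamma$, and write $\mathbf{v}_i$ for the element of $U_\Gamma$ given by $v_i$. Regard $U_\Gamma$ as a Lie algebra over $\mathbb{Z}$ with bracket $[a,b]=ab-ba$, and let $L_\Gamma$ be its Lie subalgebra generated by $\mathbf{v}_1,\dots,\mathbf{v}_r$. Then $[\mathbf{v}_i,\mathbf{v}_j]=0$ in $L_\Gamma$ whenever $[v_i,v_j]=1$ in $A_\Gamma$. Moreover, let $L$ be any Lie algebra over $\mathbb{Z}$, and let $x_1,\dots,x_r\in L$ be elements (not necessarily distinct) such that $[x_i,x_j]=0$ whenever $[v_i,v_j]=1$ in $A_\Gamma$.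 Then there is a unique Lie algebra homomorphism $\psi:L_\Gamma\to L$ with $\psi(\mathbf{v}_i)=x_i$ for $1\le i\le r$. In other words, $L_\Gamma$ is the free partially commutative Lie algebra (over $\mathbb{Z}$) on $\Gamma$. -/

import Mathlib

open scoped commutatorElement

namespace PartiallyCommutative

universe u

variable {V : Type u} (Γ : SimpleGraph V)

/-- The defining relators of the right-angled Artin group of `Γ`: the commutators of the pairs of
adjacent vertices. -/
def relators : Set (FreeGroup V) :=
  {g | ∃ i j : V, Γ.Adj i j ∧ g = ⁅FreeGroup.of i, FreeGroup.of j⁆}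

/-- The right-angled Artin group `A_Γ`, generated by the vertices of `Γ`, with the relation that
adjacent vertices commute. -/
abbrev Artin : Type u := PresentedGroup (relators Γ)

/-- The vertex `i` as an element of `A_Γ`. -/
def Artin.vertex (i : V) : Artin Γ := PresentedGroup.of i

/-- The basic swaps of words of length two: `v_i v_j` is related to `v_j v_i` when `[v_i, v_j] = 1`
in `A_Γ`. -/
def Swap (a b : FreeMonoid V) : Prop :=
  ∃ i j : V, ⁅Artin.vertex Γ i, Artin.vertex Γ j⁆ = 1 ∧
    a = FreeMonoid.of i * FreeMonoid.of j ∧ b = FreeMonoid.of j * FreeMonoid.of i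

/-- The free partially commutative monoid `M_Γ`: positive words in the vertices, modulo the
congruence generated by the swaps. -/
abbrev M : Type u := PresentedMonoid (Swap Γ)

/-- The algebra `U_Γ`: the free `ℤ`-module on `M_Γ`, with the multiplication of `M_Γ`. -/
abbrev U : Type u := MonoidAlgebra ℤ (M Γ)

/-- The Lie ring structure on the associative algebra `U_Γ`, with bracket `⁅a, b⁆ = a * b - b * a`. -/
noncomputable instance U.instLieRing : LieRing (U Γ) := LieRing.ofAssociativeRing

/-- The same, as a Lie algebra over `ℤ`. -/
noncomputable instance U.instLieAlgebra : LieAlgebra ℤ (U Γ) := LieAlgebra.ofAssociativeAlgebra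

/-- The vertex `i` as an element of `U_Γ`. -/
noncomputable def U.vertex (i : V) : U Γ :=
  MonoidAlgebra.of ℤ (M Γ) (PresentedMonoid.of (Swap Γ) i)

/-- The Lie algebra `L_Γ`: the Lie subalgebra of `U_Γ` generated by the vertices. -/
noncomputable def L : LieSubalgebra ℤ (U Γ) :=
  LieSubalgebra.lieSpan ℤ (U Γ) (Set.range (U.vertex Γ))

/-- The vertex `i` as an element of `L_Γ`. -/
noncomputable def L.vertex (i : V) : L Γ :=
  ⟨U.vertex Γ i, LieSubalgebra.subset_lieSpan (Set.mem_range_self i)⟩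

end PartiallyCommutative

-- Uniqueness holds because the vertices generate `L Γ`. Existence amounts to this: a Lie polynomial
-- f that vanishes in `U Γ` vanishes at every family x satisfying the commutation relations
-- (`lift_eq_zero_of_commute`). The proof is an induction on the number of vertices by Lazard
-- elimination. For a vertex v, f(x) is the sum of g, obtained from f by v ↦ 0 and killed by
-- induction, and of a Lie polynomial h in the elements ad(w)(x v), with w in the trace monoid of
-- the other vertices. The same g and h compute f in the endomorphisms of the free associative
-- algebra on the letters w, where v acts by multiplication by the letter 1 and every other vertex b
-- by the derivation w ↦ bw, the letters that the relations force to vanish being set to 0. This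
-- action respects the relations, so f acts as 0, and h vanishes in the free associative algebra.
--
-- To return to Lie algebras, the free Lie algebra must embed in the free associative algebra
-- (`eq_zero_of_lift_ι_eq_zero`). This is again elimination: removing letters of least weight one at
-- a time pushes the value of f at X ⊗ φ(s) arbitrarily deep into the X-adic filtration of R[X] ⊗ L,
-- so its value at X = 1 is 0.

attribute [local instance] LieRing.ofAssociativeRing

/-! ### Lie polynomials in generators that normalize a set of letters -/

namespace FreeLieAlgebra

variable {R : Type*} [CommRing R] {X L : Type*} [LieRing L] [LieAlgebra R L]

variable (R X) in
theorem lieSpan_range_of :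
    LieSubalgebra.lieSpan R (FreeLieAlgebra R X) (Set.range (of R)) = ⊤ := by
  set K := LieSubalgebra.lieSpan R (FreeLieAlgebra R X) (Set.range (of R))
  let p : FreeLieAlgebra R X →ₗ⁅R⁆ K :=
    lift R fun x => ⟨of R x, LieSubalgebra.subset_lieSpan (Set.mem_range_self x)⟩
  have hp : K.incl.comp p = LieHom.id := by
    ext x
    simp [p]
  refine eq_top_iff.2 fun f _ => ?_
  have := LieHom.congr_fun hp f
  simp only [LieHom.comp_apply, LieHom.id_apply, LieSubalgebra.coe_incl] at this
  exact this ▸ (p f).2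

theorem range_lift (f : X → L) :
    (lift R f).range = LieSubalgebra.lieSpan R L (Set.range f) := by
  rw [LieHom.range_eq_map, ← lieSpan_range_of, LieSubalgebra.map_lieSpan, ← Set.range_comp,
    of_comp_lift]

theorem comp_lift {L' : Type*} [LieRing L'] [LieAlgebra R L'] (φ : L →ₗ⁅R⁆ L') (f : X → L)
    (u : FreeLieAlgebra R X) : φ (lift R f u) = lift R (fun x => φ (f x)) u := by
  rw [← LieHom.comp_apply]
  congr 1
  ext x
  simp

/-- An induction principle for the free Lie algebra. -/
@[elab_as_elim]
theorem induction {p : FreeLieAlgebra R X → Prop} (of : ∀ x, p (of R x)) (zero : p 0)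
    (add : ∀ a b, p a → p b → p (a + b)) (smul : ∀ (r : R) a, p a → p (r • a))
    (lie : ∀ a b, p a → p b → p ⁅a, b⁆) (a : FreeLieAlgebra R X) : p a := by
  have ha : a ∈ LieSubalgebra.lieSpan R (FreeLieAlgebra R X) (Set.range (FreeLieAlgebra.of R)) := by
    rw [lieSpan_range_of]; trivial
  induction ha using LieSubalgebra.lieSpan_induction with
  | mem x h => obtain ⟨x, rfl⟩ := h; exact of x
  | zero => exact zero
  | add x y _ _ hx hy => exact add _ _ hx hy
  | smul r x _ hx => exact smul _ _ hx
  | lie x y _ _ hx hy => exact lie _ _ hx hy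

/-- Bracketing with a single `j b` is a derivation that permutes the letters, which settles
generators by the Leibniz rule; brackets in `g` then follow from the Jacobi identity. -/
theorem exists_lift_eq_lie {B S : Type*} (j : B → L) (x : S → L) (act : B → S → S)
    (hact : ∀ b s, ⁅j b, x s⁆ = x (act b s)) (g : FreeLieAlgebra R B) (h : FreeLieAlgebra R S) :
    ∃ k : FreeLieAlgebra R S, lift R x k = ⁅lift R j g, lift R x h⁆ := by
  induction g using FreeLieAlgebra.induction generalizing h with
  | of b =>
    induction h using FreeLieAlgebra.induction with
    | of s => exact ⟨of R (act b s), by simp [hact]⟩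
    | zero => exact ⟨0, by simp⟩
    | add h₁ h₂ ih₁ ih₂ =>
      obtain ⟨k₁, hk₁⟩ := ih₁
      obtain ⟨k₂, hk₂⟩ := ih₂
      exact ⟨k₁ + k₂, by simp [hk₁, hk₂]⟩
    | smul r h ih =>
      obtain ⟨k, hk⟩ := ih
      exact ⟨r • k, by simp [hk]⟩
    | lie h₁ h₂ ih₁ ih₂ =>
      obtain ⟨k₁, hk₁⟩ := ih₁
      obtain ⟨k₂, hk₂⟩ := ih₂
      refine ⟨⁅k₁, h₂⁆ + ⁅h₁, k₂⁆, ?_⟩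
      rw [LieHom.map_lie, leibniz_lie, map_add, LieHom.map_lie, LieHom.map_lie, hk₁, hk₂]
  | zero => exact ⟨0, by simp⟩
  | add g₁ g₂ ih₁ ih₂ =>
    obtain ⟨k₁, hk₁⟩ := ih₁ h
    obtain ⟨k₂, hk₂⟩ := ih₂ h
    exact ⟨k₁ + k₂, by simp [hk₁, hk₂]⟩
  | smul r g ih =>
    obtain ⟨k, hk⟩ := ih h
    exact ⟨r • k, by simp [hk]⟩
  | lie g₁ g₂ ih₁ ih₂ =>
    obtain ⟨k₁, hk₁⟩ := ih₁ h
    obtain ⟨k₂, hk₂⟩ := ih₂ h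
    obtain ⟨k₃, hk₃⟩ := ih₁ k₂
    obtain ⟨k₄, hk₄⟩ := ih₂ k₁
    exact ⟨k₃ - k₄, by rw [map_sub, hk₃, hk₄, hk₁, hk₂, LieHom.map_lie, lie_lie]⟩

/-- If every `y v` is one of the `j b` or of the `x s`, and the `j b` normalize the `x s`, then every
Lie polynomial in the `y v` is the sum of one in the `j b` and one in the `x s`. -/
theorem exists_lift_eq_add {V B S : Type*} (y : V → L) (j : B → L) (x : S → L) (act : B → S → S)
    (hact : ∀ b s, ⁅j b, x s⁆ = x (act b s))
    (hy : ∀ v, (∃ b, y v = j b) ∨ ∃ s, y v = x s) (f : FreeLieAlgebra R V) :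
    ∃ (g : FreeLieAlgebra R B) (h : FreeLieAlgebra R S), lift R y f = lift R j g + lift R x h := by
  induction f using FreeLieAlgebra.induction with
  | of v =>
    obtain ⟨b, hb⟩ | ⟨s, hs⟩ := hy v
    · exact ⟨of R b, 0, by simp [hb]⟩
    · exact ⟨0, of R s, by simp [hs]⟩
  | zero => exact ⟨0, 0, by simp⟩
  | add f₁ f₂ ih₁ ih₂ =>
    obtain ⟨g₁, h₁, e₁⟩ := ih₁
    obtain ⟨g₂, h₂, e₂⟩ := ih₂
    exact ⟨g₁ + g₂, h₁ + h₂, by simp only [map_add, e₁, e₂]; abel⟩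
  | smul r f ih =>
    obtain ⟨g, h, e⟩ := ih
    exact ⟨r • g, r • h, by simp [e]⟩
  | lie f₁ f₂ ih₁ ih₂ =>
    obtain ⟨g₁, h₁, e₁⟩ := ih₁
    obtain ⟨g₂, h₂, e₂⟩ := ih₂
    obtain ⟨k₁, hk₁⟩ := exists_lift_eq_lie j x act hact g₁ h₂
    obtain ⟨k₂, hk₂⟩ := exists_lift_eq_lie j x act hact g₂ h₁
    refine ⟨⁅g₁, g₂⁆, k₁ - k₂ + ⁅h₁, h₂⁆, ?_⟩
    simp only [LieHom.map_lie, e₁, e₂, map_add, map_sub, hk₁, hk₂, add_lie, lie_add]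
    rw [← lie_skew (lift R x h₁) (lift R j g₂)]
    abel

end FreeLieAlgebra

/-! ### Derivations of the free associative algebra -/

namespace FreeAlgebra

variable {R : Type*} [CommRing R] {S : Type*}

/-- The algebra homomorphism `a ↦ a + ε • d a` encoding the derivation `d` of the free algebra that
extends `δ`. -/
noncomputable def dualLift (δ : S → FreeAlgebra R S) :
    FreeAlgebra R S →ₐ[R] TrivSqZeroExt (FreeAlgebra R S) (FreeAlgebra R S) :=
  lift R fun s => TrivSqZeroExt.inl (ι R s) + TrivSqZeroExt.inr (δ s)

theorem fst_dualLift (δ : S → FreeAlgebra R S) (a : FreeAlgebra R S) :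
    (dualLift δ a).fst = a := by
  have : (TrivSqZeroExt.fstHom R (FreeAlgebra R S) (FreeAlgebra R S)).comp (dualLift δ) =
      AlgHom.id R _ := by
    ext s
    simp [dualLift]
  exact DFunLike.congr_fun this a

/-- The derivation of the free algebra that extends `δ`. -/
noncomputable def der (δ : S → FreeAlgebra R S) : Module.End R (FreeAlgebra R S) where
  toFun a := (dualLift δ a).snd
  map_add' := by simp
  map_smul' := by simp

@[simp] theorem der_ι (δ : S → FreeAlgebra R S) (s : S) : der δ (ι R s) = δ s := by
  simp [der, dualLift]

@[simp] theorem der_algebraMap (δ : S → FreeAlgebra R S) (r : R) :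
    der δ (algebraMap R _ r) = 0 := by
  simp [der, TrivSqZeroExt.algebraMap_eq_inl']

theorem der_mul (δ : S → FreeAlgebra R S) (a b : FreeAlgebra R S) :
    der δ (a * b) = der δ a * b + a * der δ b := by
  simp [der, fst_dualLift, add_comm]

theorem lie_der_mulLeft (δ : S → FreeAlgebra R S) (a : FreeAlgebra R S) :
    ⁅der δ, LinearMap.mulLeft R a⁆ = LinearMap.mulLeft R (der δ a) := by
  ext b
  simp [Ring.lie_def, der_mul]

/-- On a product the mixed terms `der δ a * der ε b` and `der ε a * der δ b` occur on both sides, so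
agreement on letters propagates. -/
theorem der_comm (δ ε : S → FreeAlgebra R S)
    (h : ∀ s, der δ (ε s) = der ε (δ s)) : der δ * der ε = der ε * der δ := by
  ext a
  induction a with
  | grade0 r => simp
  | grade1 s => simp [h]
  | mul a b ha hb =>
    simp only [Module.End.mul_apply] at ha hb
    simp only [Module.End.mul_apply, der_mul, map_add, ha, hb]
    abel
  | add a b ha hb => simpa using congrArg₂ (· + ·) ha hb

end FreeAlgebra

/-! ### Lazard elimination -/

namespace FreeLieAlgebra

variable {R : Type*} [CommRing R] {V B S L : Type*} [LieRing L] [LieAlgebra R L]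

/-- The left regular representation of an associative algebra, as a Lie algebra homomorphism. -/
noncomputable def mulLeftHom (A : Type*) [Ring A] [Algebra R A] : A →ₗ⁅R⁆ Module.End R A :=
  (Algebra.lmul R A).toLieHom

/-- Lazard elimination of the generators in `B`: a Lie polynomial in the generators `V` is the sum of
one in `B` and one in the letters `S`, simultaneously in `L` and in the endomorphisms of the free
algebra on `S`, where `B` acts by derivations. -/
theorem exists_elimination (q : V → FreeLieAlgebra R B) (y : V → L)
    (θ : V → Module.End R (FreeAlgebra R S)) (j : B → L) (x : S → L) (e : S → FreeAlgebra R S)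
    (act : B → S → S) (hx : ∀ b s, ⁅j b, x s⁆ = x (act b s))
    (he : ∀ b s, FreeAlgebra.der (fun t => e (act b t)) (e s) = e (act b s))
    (hV : ∀ v, (∃ b, q v = of R b ∧ y v = j b ∧ θ v = FreeAlgebra.der (fun t => e (act b t))) ∨
      ∃ s, q v = 0 ∧ y v = x s ∧ θ v = LinearMap.mulLeft R (e s)) (f : FreeLieAlgebra R V) :
    ∃ h : FreeLieAlgebra R S, lift R y f = lift R j (lift R q f) + lift R x h ∧
      lift R θ f = lift R (fun b => FreeAlgebra.der (fun t => e (act b t))) (lift R q f) +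
        LinearMap.mulLeft R (lift R e h) := by
  let d : B → Module.End R (FreeAlgebra R S) := fun b => FreeAlgebra.der (fun t => e (act b t))
  -- Working in a product of three Lie algebras yields one pair g, h valid in all of them. The first
  -- factor, where the letters of `S` are 0, identifies g as `lift R q f`.
  obtain ⟨g, h, hf⟩ := exists_lift_eq_add (R := R)
    (fun v => (q v, (y v, θ v))) (fun b => (of R b, (j b, d b)))
    (fun s => ((0 : FreeLieAlgebra R B), (x s, LinearMap.mulLeft R (e s)))) act
    (fun b s => by
      simp only [LieAlgebra.Prod.bracket_apply, lie_zero, hx, d, FreeAlgebra.lie_der_mulLeft, he])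
    (fun v => by
      rcases hV v with ⟨b, h₁, h₂, h₃⟩ | ⟨s, h₁, h₂, h₃⟩
      · exact Or.inl ⟨b, by simp only [h₁, h₂, h₃, d]⟩
      · exact Or.inr ⟨s, by simp only [h₁, h₂, h₃]⟩) f
  have h₁ := congrArg (LieHom.fst R _ _) hf
  have h₂ := congrArg (LieHom.fst R _ _) (congrArg (LieHom.snd R _ _) hf)
  have h₃ := congrArg (LieHom.snd R _ _) (congrArg (LieHom.snd R _ _) hf)
  simp only [map_add, comp_lift] at h₁ h₂ h₃
  have hg : lift R q f = g := by
    refine h₁.trans ?_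
    have e₁ : lift R (fun b => LieHom.fst R _ (L × Module.End R (FreeAlgebra R S))
        (of R b, (j b, d b))) = LieHom.id := by ext; simp
    have e₂ : lift R (fun s => LieHom.fst R _ (L × Module.End R (FreeAlgebra R S))
        ((0 : FreeLieAlgebra R B), (x s, LinearMap.mulLeft R (e s)))) = 0 := by ext; simp
    rw [e₁, e₂]
    simp
  refine ⟨h, hg ▸ h₂, ?_⟩
  rw [hg]
  refine h₃.trans ?_
  congr 1
  exact (comp_lift (mulLeftHom (R := R) (FreeAlgebra R S)) e h).symm

end FreeLieAlgebra

/-! ### Elimination of one letter at a time in a filtered Lie algebra -/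

namespace FreeLieAlgebra

variable {R : Type*} [CommRing R] {L : Type*} [LieRing L] [LieAlgebra R L]

/-- A Lie polynomial that vanishes in the free associative algebra vanishes in every associative
algebra. -/
theorem lift_eq_zero_of_lift_ι_eq_zero {V A : Type*} [Ring A] [Algebra R A]
    {f : FreeLieAlgebra R V} (hf : lift R (FreeAlgebra.ι R) f = 0) (θ : V → A) :
    lift R θ f = 0 := by
  have := comp_lift (FreeAlgebra.lift R θ).toLieHom (FreeAlgebra.ι R) f
  simp only [hf, AlgHom.coe_toLieHom, FreeAlgebra.lift_ι_apply] at this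
  rw [← this]
  exact map_zero _

theorem exists_eq_smul_of_unique (g : FreeLieAlgebra R Unit) : ∃ c : R, g = c • of R () := by
  induction g using FreeLieAlgebra.induction with
  | of x => exact ⟨1, by simp⟩
  | zero => exact ⟨0, by simp⟩
  | add a b ha hb =>
    obtain ⟨c, rfl⟩ := ha
    obtain ⟨d, rfl⟩ := hb
    exact ⟨c + d, by rw [add_smul]⟩
  | smul r a ha =>
    obtain ⟨c, rfl⟩ := ha
    exact ⟨r * c, by rw [mul_smul]⟩
  | lie a b ha hb =>
    obtain ⟨c, rfl⟩ := ha
    obtain ⟨d, rfl⟩ := hb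
    exact ⟨0, by simp⟩

theorem lift_mem_of_le {S : Type*} (G : ℕ → Submodule R L) (anti : Antitone G)
    (hG : ∀ i j x y, x ∈ G i → y ∈ G j → ⁅x, y⁆ ∈ G (i + j)) {n : ℕ} {φ : S → L}
    (hφ : ∀ s, φ s ∈ G n) (f : FreeLieAlgebra R S) : lift R φ f ∈ G n := by
  induction f using FreeLieAlgebra.induction with
  | of s => simpa using hφ s
  | zero => simp
  | add a b ha hb => simpa using add_mem ha hb
  | smul r a ha => simpa using (G n).smul_mem r ha
  | lie a b ha hb =>
    rw [LieHom.map_lie]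
    exact anti (Nat.le_add_left n n) (hG _ _ _ _ ha hb)

theorem ad_pow_mem (G : ℕ → Submodule R L)
    (hG : ∀ i j x y, x ∈ G i → y ∈ G j → ⁅x, y⁆ ∈ G (i + j)) {m w : ℕ} {a z : L}
    (ha : a ∈ G m) (hz : z ∈ G w) (i : ℕ) : (LieAlgebra.ad R L a ^ i) z ∈ G (i * m + w) := by
  induction i with
  | zero => simpa using hz
  | succ i ih =>
    rw [pow_succ', Module.End.mul_apply, LieAlgebra.ad_apply]
    convert hG _ _ _ _ ha ih using 2
    ring

open Classical in
/-- Elimination of one letter `a` from a Lie polynomial that vanishes in the free associative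
algebra. -/
theorem exists_lift_ad_pow {S : Type*} (a : S) (φ : S → L) {f : FreeLieAlgebra R S}
    (hf : lift R (FreeAlgebra.ι R) f = 0) :
    ∃ h : FreeLieAlgebra R (ℕ × {z : S // z ≠ a}), lift R (FreeAlgebra.ι R) h = 0 ∧
      lift R φ f = lift R (fun s => (LieAlgebra.ad R L (φ a) ^ s.1) (φ s.2)) h := by
  let act : Unit → ℕ × {z : S // z ≠ a} → ℕ × {z : S // z ≠ a} := fun _ s => (s.1 + 1, s.2)
  obtain ⟨h, h₁, h₂⟩ := exists_elimination (R := R)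
    (fun v => if v = a then of R () else 0) φ
    (fun v => if hv : v = a then FreeAlgebra.der (fun t => FreeAlgebra.ι R (act () t))
      else LinearMap.mulLeft R (FreeAlgebra.ι R ((0, ⟨v, hv⟩) : ℕ × {z : S // z ≠ a})))
    (fun _ => φ a) (fun s => (LieAlgebra.ad R L (φ a) ^ s.1) (φ s.2))
    (FreeAlgebra.ι R) act
    (fun b s => by simp [act, pow_succ'])
    (fun b s => by simp)
    (fun v => by
      by_cases hv : v = a
      · exact Or.inl ⟨(), by simp [hv]⟩
      · exact Or.inr ⟨(0, ⟨v, hv⟩), by simp [hv]⟩) f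
  -- This element is c times the one generator. The coefficient c is the value of f in the
  -- commutative algebra `R` at a ↦ 1 and all other letters ↦ 0, and f vanishes in every associative
  -- algebra.
  have hg : lift R (fun v => if v = a then of R () else 0) f = 0 := by
    obtain ⟨c, hc⟩ := exists_eq_smul_of_unique (lift R (fun v => if v = a then of R () else 0) f)
    have h₃ := lift_eq_zero_of_lift_ι_eq_zero hf (fun v => if v = a then (1 : R) else 0)
    have h₄ := comp_lift (lift R (fun _ : Unit => (1 : R)))
      (fun v => if v = a then of R () else 0) f
    simp only [apply_ite (lift R (fun _ : Unit => (1 : R))), lift_of_apply, map_zero] at h₄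
    rw [h₃, hc, map_smul, lift_of_apply, smul_eq_mul, mul_one] at h₄
    rw [hc, h₄, zero_smul]
  rw [hg, map_zero, zero_add] at h₁ h₂
  rw [lift_eq_zero_of_lift_ι_eq_zero hf] at h₂
  refine ⟨h, ?_, h₁⟩
  -- Left multiplication by the image of h is zero; apply it to 1.
  simpa using (DFunLike.congr_fun h₂ 1).symm

/-- A Lie polynomial that vanishes in the free associative algebra lies arbitrarily deep in every
filtration that is compatible with a weighting of the letters. -/
theorem lift_mem_of_lift_ι_eq_zero (G : ℕ → Submodule R L) (anti : Antitone G)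
    (hG : ∀ i j x y, x ∈ G i → y ∈ G j → ⁅x, y⁆ ∈ G (i + j)) (n k m : ℕ) (hn : n ≤ m + k)
    (hm : 1 ≤ m) {S : Type u} (wt : S → ℕ) (hfin : ∀ i, {s | wt s = i}.Finite)
    (hwt : ∀ s, m ≤ wt s) (φ : S → L) (hφ : ∀ s, φ s ∈ G (wt s)) (f : FreeLieAlgebra R S)
    (hf : lift R (FreeAlgebra.ι R) f = 0) : lift R φ f ∈ G n := by
  -- Outer induction on the distance k left from the least weight m to n, inner induction on the
  -- number of letters of weight exactly m.
  induction k generalizing m S with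
  | zero => exact lift_mem_of_le G anti hG (fun s => anti (hn.trans (hwt s)) (hφ s)) f
  | succ k ihk =>
    induction hc : {s | wt s = m}.ncard generalizing S with
    | zero =>
      rw [Set.ncard_eq_zero (hfin m)] at hc
      refine ihk (m + 1) (by lia) (by lia) wt hfin (fun s => ?_) φ hφ f hf
      refine lt_of_le_of_ne (hwt s) fun h => ?_
      exact (Set.eq_empty_iff_forall_notMem.1 hc s) h.symm
    | succ c ihc =>
      obtain ⟨a, ha⟩ := Set.nonempty_of_ncard_ne_zero (hc.trans_ne (Nat.succ_ne_zero c))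
      obtain ⟨h, h₀, h₁⟩ := exists_lift_ad_pow a φ hf
      rw [h₁]
      -- The letter ad(a)^l z gets weight l * m + wt z. As m ≥ 1, every weight still has finitely
      -- many letters. Those of weight m are the old ones with l = 0, except a itself.
      refine ihc (fun s => s.1 * m + wt s.2) (fun i => ?_)
        (fun s => (hwt s.2).trans (Nat.le_add_left _ _)) _
        (fun s => ad_pow_mem G hG (by rw [← show wt a = m from ha]; exact hφ a) (hφ s.2) s.1)
        h h₀ ?_
      · have hb : {s : S | wt s ≤ i}.Finite := by
          refine ((Set.finite_Iic i).biUnion fun j _ => hfin j).subset fun s hs => ?_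
          simpa using hs
        refine ((Set.finite_Iic i).prod
          (hb.preimage (Subtype.val_injective (p := (· ≠ a))).injOn)).subset ?_
        rintro ⟨l, z⟩ (hz : l * m + wt z = i)
        simp only [Set.mem_prod, Set.mem_Iic, Set.mem_preimage, Set.mem_ofPred_eq]
        constructor <;> nlinarith
      · have himg : (fun s : ℕ × {z : S // z ≠ a} => (s.2 : S)) ''
            {s | s.1 * m + wt s.2 = m} = {s | wt s = m} \ {a} := by
          ext z
          simp only [Set.mem_image, Set.mem_ofPred_eq, Set.mem_sdiff, Set.mem_singleton_iff]
          constructor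
          · rintro ⟨⟨l, z, hz⟩, h, rfl⟩
            refine ⟨?_, hz⟩
            have := hwt z
            rcases Nat.eq_zero_or_pos l with rfl | hl
            · simpa using h
            · simp only at h
              nlinarith
          · rintro ⟨h, hz⟩
            exact ⟨(0, ⟨z, hz⟩), by simpa using h, rfl⟩
        rw [← Set.InjOn.ncard_image (f := fun s : ℕ × {z : S // z ≠ a} => (s.2 : S)), himg,
          Set.ncard_sdiff_singleton_of_mem ha, hc, Nat.add_sub_cancel]
        rintro ⟨l, z⟩ (hz : l * m + wt z = m) ⟨l', z'⟩ (hz' : l' * m + wt z' = m) (h : z.1 = z'.1)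
        have hl : l = 0 := by
          have := hwt z
          by_contra h0
          have : 1 ≤ l := Nat.one_le_iff_ne_zero.2 h0
          nlinarith
        have hl' : l' = 0 := by
          have := hwt z'
          by_contra h0
          have : 1 ≤ l' := Nat.one_le_iff_ne_zero.2 h0
          nlinarith
        exact Prod.ext (hl.trans hl'.symm) (Subtype.ext h)

end FreeLieAlgebra

/-! ### The X-adic filtration of R[X] ⊗ L -/

section PolynomialExtension

open TensorProduct Polynomial

variable (R : Type*) [CommRing R] (L : Type*) [LieRing L] [LieAlgebra R L]

/-- The coefficient of `X ^ k` of an element of `R[X] ⊗ L`. -/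
noncomputable def tensorCoeff (k : ℕ) : R[X] ⊗[R] L →ₗ[R] L :=
  TensorProduct.lift ((LinearMap.lsmul R L).comp (lcoeff R k))

/-- Evaluation at `X = 1` of an element of `R[X] ⊗ L`. -/
noncomputable def tensorEvalOne : R[X] ⊗[R] L →ₗ⁅R⁆ L where
  toLinearMap := TensorProduct.lift ((LinearMap.lsmul R L).comp (leval 1))
  map_lie' {x y} := by
    simp only [AddHom.toFun_eq_coe, LinearMap.coe_toAddHom]
    induction x with
    | zero => simp
    | add x₁ x₂ h₁ h₂ => simp only [add_lie, map_add, h₁, h₂]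
    | tmul p a =>
      induction y with
      | zero => simp
      | add y₁ y₂ h₁ h₂ => simp only [lie_add, map_add, h₁, h₂]
      | tmul q b => simp [LieAlgebra.ExtendScalars.bracket_tmul, mul_smul, smul_comm (eval 1 q)]

variable {R L}

@[simp] theorem tensorCoeff_tmul (k : ℕ) (p : R[X]) (a : L) :
    tensorCoeff R L k (p ⊗ₜ a) = p.coeff k • a := rfl

@[simp] theorem tensorEvalOne_tmul (p : R[X]) (a : L) :
    tensorEvalOne R L (p ⊗ₜ a) = p.eval 1 • a := rfl

theorem tensorCoeff_X_pow_smul {k n : ℕ} (h : k < n) (z : R[X] ⊗[R] L) :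
    tensorCoeff R L k ((X ^ n : R[X]) • z) = 0 := by
  induction z with
  | zero => simp
  | add x y hx hy => simp [hx, hy]
  | tmul p a => simp [TensorProduct.smul_tmul', coeff_X_pow_mul', Nat.not_le.2 h]

theorem exists_tensorEvalOne_eq_sum (z : R[X] ⊗[R] L) :
    ∃ N, ∀ n ≥ N, tensorEvalOne R L z = ∑ k ∈ Finset.range n, tensorCoeff R L k z := by
  induction z with
  | zero => exact ⟨0, by simp⟩
  | add x y hx hy =>
    obtain ⟨N, hN⟩ := hx
    obtain ⟨M, hM⟩ := hy
    refine ⟨max N M, fun n hn => ?_⟩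
    simp only [map_add, Finset.sum_add_distrib, hN n (le_of_max_le_left hn),
      hM n (le_of_max_le_right hn)]
  | tmul p a =>
    refine ⟨p.natDegree + 1, fun n hn => ?_⟩
    simp only [tensorEvalOne_tmul, tensorCoeff_tmul, ← Finset.sum_smul]
    rw [eval_eq_sum_range' (Nat.lt_of_succ_le hn)]
    simp

variable (R L) in
/-- The `X`-adic filtration of `R[X] ⊗ L`. -/
noncomputable def tensorFiltration (n : ℕ) : Submodule R (R[X] ⊗[R] L) :=
  (LinearMap.lsmul R[X] (R[X] ⊗[R] L) (X ^ n)).range.restrictScalars R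

theorem mem_tensorFiltration {n : ℕ} {z : R[X] ⊗[R] L} :
    z ∈ tensorFiltration R L n ↔ ∃ w, (X ^ n : R[X]) • w = z := Iff.rfl

theorem tensorFiltration_antitone : Antitone (tensorFiltration R L) := by
  intro m n hmn z hz
  obtain ⟨w, rfl⟩ := mem_tensorFiltration.1 hz
  refine mem_tensorFiltration.2 ⟨(X ^ (n - m) : R[X]) • w, ?_⟩
  rw [smul_smul, ← pow_add, Nat.add_sub_cancel' hmn]

theorem lie_mem_tensorFiltration (i j : ℕ) (x y : R[X] ⊗[R] L) (hx : x ∈ tensorFiltration R L i)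
    (hy : y ∈ tensorFiltration R L j) : ⁅x, y⁆ ∈ tensorFiltration R L (i + j) := by
  obtain ⟨v, rfl⟩ := mem_tensorFiltration.1 hx
  obtain ⟨w, rfl⟩ := mem_tensorFiltration.1 hy
  refine mem_tensorFiltration.2 ⟨⁅v, w⁆, ?_⟩
  have h₁ : ⁅(X ^ i : R[X]) • v, (X ^ j : R[X]) • w⁆ = (X ^ i : R[X]) • ⁅v, (X ^ j : R[X]) • w⁆ :=
    smul_lie (X ^ i : R[X]) v ((X ^ j : R[X]) • w)
  have h₂ : ⁅v, (X ^ j : R[X]) • w⁆ = (X ^ j : R[X]) • ⁅v, w⁆ := lie_smul (X ^ j : R[X]) v w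
  rw [h₁, h₂, smul_smul, pow_add]

theorem X_tmul_mem_tensorFiltration (a : L) :
    (X : R[X]) ⊗ₜ[R] a ∈ tensorFiltration R L 1 :=
  mem_tensorFiltration.2 ⟨1 ⊗ₜ a, by simp [TensorProduct.smul_tmul']⟩

/-- The value at 1 is a finite sum of coefficients, and divisibility by X^(k+1) kills the k-th one.
-/
theorem tensorEvalOne_eq_zero {z : R[X] ⊗[R] L} (hz : ∀ n, z ∈ tensorFiltration R L n) :
    tensorEvalOne R L z = 0 := by
  obtain ⟨N, hN⟩ := exists_tensorEvalOne_eq_sum z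
  rw [hN N le_rfl]
  refine Finset.sum_eq_zero fun k _ => ?_
  obtain ⟨w, rfl⟩ := mem_tensorFiltration.1 (hz (k + 1))
  exact tensorCoeff_X_pow_smul (Nat.lt_succ_self k) w

/-- Scaling the letters by X puts them all in weight 1, so no grading on `L` is needed. Finiteness
of `S` makes each weight class finite. -/
theorem FreeLieAlgebra.lift_eq_zero_of_finite {S : Type*} [Finite S] (φ : S → L)
    {f : FreeLieAlgebra R S} (hf : FreeLieAlgebra.lift R (FreeAlgebra.ι R) f = 0) :
    FreeLieAlgebra.lift R φ f = 0 := by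
  have key : ∀ n, FreeLieAlgebra.lift R (fun s => (X : R[X]) ⊗ₜ[R] φ s) f ∈
      tensorFiltration R L n := fun n =>
    FreeLieAlgebra.lift_mem_of_lift_ι_eq_zero (tensorFiltration R L) tensorFiltration_antitone
      lie_mem_tensorFiltration n n 1 (Nat.le_add_left _ _) le_rfl (fun _ => 1)
      (fun _ => Set.toFinite _) (fun _ => le_rfl) _
      (fun s => X_tmul_mem_tensorFiltration (φ s)) f hf
  have h := tensorEvalOne_eq_zero key
  rw [FreeLieAlgebra.comp_lift] at h
  simpa only [tensorEvalOne_tmul, eval_X, one_smul] using h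

end PolynomialExtension

/-! ### The free Lie algebra embeds in the free associative algebra -/

namespace FreeLieAlgebra

open TensorProduct Polynomial

variable {R : Type*} [CommRing R]

theorem eq_zero_of_lift_ι_eq_zero_of_finite {S : Type*} [Finite S] {f : FreeLieAlgebra R S}
    (hf : lift R (FreeAlgebra.ι R) f = 0) : f = 0 := by
  have h := lift_eq_zero_of_finite (of R) hf
  have e : lift R (of R) = (LieHom.id : FreeLieAlgebra R S →ₗ⁅R⁆ _) := by
    ext s
    simp
  rwa [e] at h

-- A Lie polynomial involves finitely many letters, which reduces the embedding to finite alphabets.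
-- Quantifying over larger `T'` lets two supports be merged.
open Classical in
theorem exists_finset_support {S : Type*} (f : FreeLieAlgebra R S) :
    ∃ T : Finset S, ∀ T', T ⊆ T' → lift R (fun s => if s ∈ T' then of R s else 0) f = f := by
  induction f using FreeLieAlgebra.induction with
  | of s => exact ⟨{s}, fun T' h => by simp [h (Finset.mem_singleton_self s)]⟩
  | zero => exact ⟨∅, by simp⟩
  | add a b ha hb =>
    obtain ⟨T, hT⟩ := ha
    obtain ⟨U, hU⟩ := hb
    refine ⟨T ∪ U, fun T' h => ?_⟩
    rw [map_add, hT T' (Finset.union_subset_left h), hU T' (Finset.union_subset_right h)]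
  | smul r a ha =>
    obtain ⟨T, hT⟩ := ha
    exact ⟨T, fun T' h => by rw [map_smul, hT T' h]⟩
  | lie a b ha hb =>
    obtain ⟨T, hT⟩ := ha
    obtain ⟨U, hU⟩ := hb
    refine ⟨T ∪ U, fun T' h => ?_⟩
    rw [LieHom.map_lie, hT T' (Finset.union_subset_left h), hU T' (Finset.union_subset_right h)]

/-- The free Lie algebra embeds in the free associative algebra, over every commutative ring. -/
theorem eq_zero_of_lift_ι_eq_zero {S : Type*} {f : FreeLieAlgebra R S}
    (hf : lift R (FreeAlgebra.ι R) f = 0) : f = 0 := by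
  classical
  obtain ⟨T, hT⟩ := exists_finset_support f
  let r : S → FreeLieAlgebra R T := fun s => if h : s ∈ T then of R ⟨s, h⟩ else 0
  have hr : lift R r f = 0 := by
    refine eq_zero_of_lift_ι_eq_zero_of_finite ?_
    rw [comp_lift]
    exact lift_eq_zero_of_lift_ι_eq_zero hf _
  have h := comp_lift (lift R fun s : T => of R (s : S)) r f
  rw [hr, map_zero] at h
  refine (hT T subset_rfl).symm.trans (Eq.trans ?_ h.symm)
  refine DFunLike.congr_fun (congrArg (lift R) ?_) f
  ext s
  by_cases hs : s ∈ T <;> simp [r, hs]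

end FreeLieAlgebra

/-! ### Free partially commutative monoids -/

section TraceMonoid

/-- The relation `ij ~ ji` on words, for the pairs of letters that are related by `C`. -/
def traceRel {V : Type*} (C : V → V → Prop) (a b : FreeMonoid V) : Prop :=
  ∃ i j : V, C i j ∧ a = FreeMonoid.of i * FreeMonoid.of j ∧ b = FreeMonoid.of j * FreeMonoid.of i

/-- The free partially commutative monoid in which `i` and `j` commute when `C i j`. -/
abbrev TraceMonoid {V : Type*} (C : V → V → Prop) : Type _ := PresentedMonoid (traceRel C)

namespace TraceMonoid

variable {V : Type*} {C : V → V → Prop}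

theorem of_mul_of {i j : V} (h : C i j) :
    (PresentedMonoid.of (traceRel C) i * PresentedMonoid.of (traceRel C) j) =
      PresentedMonoid.of (traceRel C) j * PresentedMonoid.of (traceRel C) i := by
  simp only [PresentedMonoid.of, ← map_mul]
  exact PresentedMonoid.mk_eq_mk_of_rel ⟨i, j, h, rfl, rfl⟩

/-- The homomorphism from a free partially commutative monoid given by commuting elements. -/
def lift {M : Type*} [Monoid M] (y : V → M) (hy : ∀ i j, C i j → y i * y j = y j * y i) :
    TraceMonoid C →* M :=
  PresentedMonoid.lift y (by
    rintro _ _ ⟨i, j, h, rfl, rfl⟩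
    simpa using hy i j h)

theorem lift_of {M : Type*} [Monoid M] (y : V → M) (hy : ∀ i j, C i j → y i * y j = y j * y i)
    (i : V) : lift y hy (PresentedMonoid.of _ i) = y i := PresentedMonoid.lift_of _ _

end TraceMonoid

end TraceMonoid

/-! ### Induction on the number of vertices -/

namespace FreeLieAlgebra

variable {R : Type*} [CommRing R]

/-- The canonical homomorphism from the free Lie algebra to the algebra of the free partially
commutative monoid. -/
noncomputable def toTraceAlgebra (R : Type*) [CommRing R] {V : Type*} (C : V → V → Prop) :
    FreeLieAlgebra R V →ₗ⁅R⁆ MonoidAlgebra R (TraceMonoid C) :=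
  lift R fun v => MonoidAlgebra.of R (TraceMonoid C) (PresentedMonoid.of _ v)

theorem lift_eq_zero_of_toTraceAlgebra_eq_zero {V : Type*} {C : V → V → Prop}
    {f : FreeLieAlgebra R V} (hf : toTraceAlgebra R C f = 0) {A : Type*} [Ring A] [Algebra R A]
    (θ : V → A) (hθ : ∀ i j, C i j → θ i * θ j = θ j * θ i) : lift R θ f = 0 := by
  have h := comp_lift (MonoidAlgebra.lift R A (TraceMonoid C) (TraceMonoid.lift θ hθ)).toLieHom
    (fun v => MonoidAlgebra.of R (TraceMonoid C) (PresentedMonoid.of _ v)) f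
  have e : (fun v => (MonoidAlgebra.lift R A (TraceMonoid C) (TraceMonoid.lift θ hθ)).toLieHom
      (MonoidAlgebra.of R (TraceMonoid C) (PresentedMonoid.of _ v))) = θ := by
    ext v
    simp [TraceMonoid.lift_of]
  rw [e] at h
  rw [← h]
  exact (congrArg _ hf).trans (map_zero _)

/-- A Lie polynomial that vanishes in the algebra of a free partially commutative monoid vanishes in
every Lie algebra on elements that satisfy the same commutation relations. -/
theorem lift_eq_zero_of_commute (n : ℕ) {L : Type*} [LieRing L] [LieAlgebra R L] {V : Type u}
    [Finite V] (hn : Nat.card V = n) (C : V → V → Prop) (x : V → L)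
    (hx : ∀ i j, C i j → ⁅x i, x j⁆ = 0) {f : FreeLieAlgebra R V}
    (hf : toTraceAlgebra R C f = 0) : lift R x f = 0 := by
  classical
  induction n generalizing V with
  | zero =>
    have : IsEmpty V := Finite.card_eq_zero_iff.1 hn
    have : lift R x = 0 := by
      ext v
      exact isEmptyElim v
    simp [this]
  | succ n ih =>
    obtain ⟨v⟩ : Nonempty V := (Nat.card_pos_iff.1 (by lia)).1
    let C' : {w : V // w ≠ v} → {w : V // w ≠ v} → Prop := fun b c => C b c
    let o : {w : V // w ≠ v} → TraceMonoid C' := PresentedMonoid.of _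
    let ρ : TraceMonoid C' →* Module.End R L :=
      TraceMonoid.lift (fun b => LieAlgebra.ad R L (x b)) fun b c h => by
        rw [← sub_eq_zero, ← Ring.lie_def, ← LieHom.map_lie, hx _ _ h, map_zero]
    have hρ : ∀ b, ρ (o b) = LieAlgebra.ad R L (x b) := fun b => TraceMonoid.lift_of _ _ b
    -- The words that can be written with a last letter commuting with v; they annihilate `x v`.
    -- They are stable under left multiplication, so setting their letters to 0 is compatible with
    -- the derivations.
    let bad : TraceMonoid C' → Prop := fun w =>
      ∃ (w' : TraceMonoid C') (b : {w : V // w ≠ v}), (C b v ∨ C v b) ∧ w = w' * o b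
    have bad_mul : ∀ b w, bad w → bad (o b * w) := by
      rintro b _ ⟨w', c, hc, rfl⟩
      exact ⟨o b * w', c, hc, by rw [mul_assoc]⟩
    have hbad : ∀ w, bad w → ρ w (x v) = 0 := by
      rintro _ ⟨w', c, hc, rfl⟩
      have : ⁅x c, x v⁆ = 0 := by
        rcases hc with hc | hc
        · exact hx _ _ hc
        · rw [← lie_skew, hx _ _ hc, neg_zero]
      rw [map_mul, Module.End.mul_apply, hρ, LieAlgebra.ad_apply, this, map_zero]
    let e : TraceMonoid C' → FreeAlgebra R (TraceMonoid C') :=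
      fun w => if bad w then 0 else FreeAlgebra.ι R w
    let d : {w : V // w ≠ v} → Module.End R (FreeAlgebra R (TraceMonoid C')) :=
      fun b => FreeAlgebra.der fun w => e (o b * w)
    have he : ∀ b w, d b (e w) = e (o b * w) := by
      intro b w
      by_cases hw : bad w
      · simp [e, hw, bad_mul b w hw]
      · simp only [d, e, if_neg hw, FreeAlgebra.der_ι]
    have hd : ∀ b c, C' b c → d b * d c = d c * d b := by
      intro b c hbc
      refine FreeAlgebra.der_comm _ _ fun w => ?_
      refine (he b (o c * w)).trans (Eq.trans ?_ (he c (o b * w)).symm)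
      rw [← mul_assoc, ← mul_assoc, TraceMonoid.of_mul_of hbc]
    -- If b commutes with v, the word b is bad, so the derivation of b kills the letter 1 and
    -- commutes with multiplication by it.
    have hdv : ∀ b : {w : V // w ≠ v}, (C b v ∨ C v b) →
        d b * LinearMap.mulLeft R (e 1) = LinearMap.mulLeft R (e 1) * d b := by
      intro b hb
      have h0 : bad (o b * 1) := ⟨1, b, hb, by simp⟩
      have h1 : d b (e 1) = 0 := by
        rw [he]
        exact if_pos h0
      rw [← sub_eq_zero, ← Ring.lie_def, FreeAlgebra.lie_der_mulLeft]
      exact (congrArg _ h1).trans (LinearMap.mulLeft_zero_eq_zero _ _)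
    let θ : V → Module.End R (FreeAlgebra R (TraceMonoid C')) :=
      fun u => if hu : u = v then LinearMap.mulLeft R (e 1) else d ⟨u, hu⟩
    have hθ : ∀ i j, C i j → θ i * θ j = θ j * θ i := by
      intro i j hij
      by_cases hi : i = v
      · by_cases hj : j = v
        · rw [hi, hj]
        · subst hi
          simp only [θ, dif_neg hj, dif_pos]
          exact (hdv ⟨j, hj⟩ (Or.inr hij)).symm
      · by_cases hj : j = v
        · subst hj
          simp only [θ, dif_neg hi, dif_pos]
          exact hdv ⟨i, hi⟩ (Or.inl hij)
        · simp only [θ, dif_neg hi, dif_neg hj]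
          exact hd ⟨i, hi⟩ ⟨j, hj⟩ hij
    let q : V → FreeLieAlgebra R {w : V // w ≠ v} :=
      fun u => if hu : u = v then 0 else of R ⟨u, hu⟩
    obtain ⟨h, h₁, h₂⟩ := exists_elimination (R := R) q x θ (fun b => x b) (fun w => ρ w (x v)) e
      (fun b w => o b * w)
      (fun b w => by rw [map_mul, Module.End.mul_apply, hρ, LieAlgebra.ad_apply]) he
      (fun u => by
        by_cases hu : u = v
        · exact Or.inr ⟨1, by simp [q, θ, hu]⟩
        · exact Or.inl ⟨⟨u, hu⟩, by simp [q, θ, hu, d]⟩) f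
    -- Sending v to 0 preserves the commutation relations, so the hypothesis on f passes to the
    -- remaining vertices.
    have hg : toTraceAlgebra R C' (lift R q f) = 0 := by
      rw [comp_lift]
      refine lift_eq_zero_of_toTraceAlgebra_eq_zero hf _ fun i j hij => ?_
      by_cases hi : i = v
      · simp [q, hi]
      · by_cases hj : j = v
        · simp [q, hj]
        · simp only [q, dif_neg hi, dif_neg hj, toTraceAlgebra, lift_of_apply, ← map_mul]
          rw [TraceMonoid.of_mul_of (C := C') (i := ⟨i, hi⟩) (j := ⟨j, hj⟩) hij]
    have hcard : Nat.card {w : V // w ≠ v} = n := by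
      have := Fintype.ofFinite V
      rw [Nat.card_eq_fintype_card] at hn ⊢
      rw [Fintype.card_subtype_compl, Fintype.card_subtype_eq, hn, Nat.add_sub_cancel]
    rw [ih hcard C' (fun b => x b) (fun b c => hx b c) hg, zero_add] at h₁
    have h₃ := lift_eq_zero_of_toTraceAlgebra_eq_zero hg d hd
    rw [lift_eq_zero_of_toTraceAlgebra_eq_zero hf θ hθ, h₃, zero_add] at h₂
    have h₄ : lift R e h = 0 := by simpa using (DFunLike.congr_fun h₂ 1).symm
    -- `e'` lifts `e` to the free Lie algebra, where h vanishes by the embedding. Evaluation at the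
    -- elements `ρ w (x v)` factors through `e'` because it kills the bad letters.
    let e' : TraceMonoid C' → FreeLieAlgebra R (TraceMonoid C') :=
      fun w => if bad w then 0 else of R w
    have h₅ : lift R e' h = 0 := by
      refine eq_zero_of_lift_ι_eq_zero ?_
      rw [comp_lift, ← h₄]
      refine DFunLike.congr_fun (congrArg (lift R) (funext fun w => ?_)) h
      by_cases hw : bad w <;> simp [e, e', hw]
    have h₆ := comp_lift (lift R fun w => ρ w (x v)) e' h
    rw [h₅, map_zero] at h₆
    rw [h₁, h₆]
    refine DFunLike.congr_fun (congrArg (lift R) (funext fun w => ?_)) h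
    by_cases hw : bad w
    · simp [e', hw, hbad w hw]
    · simp [e', hw]

end FreeLieAlgebra

/-! ### Factorization through a surjective homomorphism -/

namespace LieHom

variable {R K P Q : Type*} [CommRing R] [LieRing K] [LieAlgebra R K] [LieRing P] [LieAlgebra R P]
  [LieRing Q] [LieAlgebra R Q]

theorem apply_surjInv_apply {p : K →ₗ⁅R⁆ P} (hp : Function.Surjective p) {φ : K →ₗ⁅R⁆ Q}
    (h : ∀ f, p f = 0 → φ f = 0) (f : K) : φ (Function.surjInv hp (p f)) = φ f := by
  rw [← sub_eq_zero, ← map_sub]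
  exact h _ (by rw [map_sub, Function.surjInv_eq hp, sub_self])

/-- The factorization of a Lie algebra homomorphism through a surjective one. -/
noncomputable def descend (p : K →ₗ⁅R⁆ P) (hp : Function.Surjective p) (φ : K →ₗ⁅R⁆ Q)
    (h : ∀ f, p f = 0 → φ f = 0) : P →ₗ⁅R⁆ Q where
  toFun u := φ (Function.surjInv hp u)
  map_add' u v := by
    obtain ⟨f, rfl⟩ := hp u
    obtain ⟨g, rfl⟩ := hp v
    simp only [← map_add, apply_surjInv_apply hp h]
  map_smul' r u := by
    obtain ⟨f, rfl⟩ := hp u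
    simp only [← map_smul, apply_surjInv_apply hp h, RingHom.id_apply]
  map_lie' {u v} := by
    obtain ⟨f, rfl⟩ := hp u
    obtain ⟨g, rfl⟩ := hp v
    simp only [← LieHom.map_lie, apply_surjInv_apply hp h]

theorem descend_apply (p : K →ₗ⁅R⁆ P) (hp : Function.Surjective p) (φ : K →ₗ⁅R⁆ Q)
    (h : ∀ f, p f = 0 → φ f = 0) (f : K) : p.descend hp φ h (p f) = φ f :=
  apply_surjInv_apply hp h f

end LieHom

/-! ### The universal property of `L Γ` -/

namespace PartiallyCommutative

variable {V : Type*} (Γ : SimpleGraph V)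

/-- The canonical homomorphism from the free Lie algebra onto `L_Γ`. -/
noncomputable def toL : FreeLieAlgebra ℤ V →ₗ⁅ℤ⁆ L Γ := FreeLieAlgebra.lift ℤ (L.vertex Γ)

@[simp] theorem toL_of (i : V) : toL Γ (FreeLieAlgebra.of ℤ i) = L.vertex Γ i :=
  FreeLieAlgebra.lift_of_apply _ _

theorem coe_toL (f : FreeLieAlgebra ℤ V) :
    (toL Γ f : U Γ) = FreeLieAlgebra.lift ℤ (U.vertex Γ) f :=
  FreeLieAlgebra.comp_lift (L Γ).incl (L.vertex Γ) f

theorem toL_surjective : Function.Surjective (toL Γ) := by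
  intro u
  have hu : (u : U Γ) ∈ (FreeLieAlgebra.lift ℤ (U.vertex Γ)).range := by
    rw [FreeLieAlgebra.range_lift]
    exact u.2
  obtain ⟨f, hf⟩ := hu
  exact ⟨f, Subtype.ext ((coe_toL Γ f).trans hf)⟩

theorem lie_vertex_eq_zero {i j : V} (h : ⁅Artin.vertex Γ i, Artin.vertex Γ j⁆ = 1) :
    ⁅L.vertex Γ i, L.vertex Γ j⁆ = 0 := by
  refine Subtype.ext ?_
  change U.vertex Γ i * U.vertex Γ j - U.vertex Γ j * U.vertex Γ i = 0
  rw [sub_eq_zero, U.vertex, U.vertex, ← map_mul, ← map_mul]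
  exact congrArg _ (PresentedMonoid.mk_eq_mk_of_rel ⟨i, j, h, rfl, rfl⟩)

variable {Γ} in
/-- A Lie polynomial that vanishes in `L_Γ` vanishes in every Lie algebra on elements that satisfy
the commutation relations of `Γ`. -/
theorem lift_eq_zero_of_toL_eq_zero [Finite V] {L' : Type*} [LieRing L'] [LieAlgebra ℤ L']
    (x : V → L') (hx : ∀ i j, ⁅Artin.vertex Γ i, Artin.vertex Γ j⁆ = 1 → ⁅x i, x j⁆ = 0)
    {f : FreeLieAlgebra ℤ V} (hf : toL Γ f = 0) : FreeLieAlgebra.lift ℤ x f = 0 := by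
  refine FreeLieAlgebra.lift_eq_zero_of_commute _ rfl
    (fun i j => ⁅Artin.vertex Γ i, Artin.vertex Γ j⁆ = 1) x hx ?_
  have h := coe_toL Γ f
  rw [hf] at h
  exact h.symm

/-- The homomorphism from `L_Γ` given by elements that satisfy the commutation relations of `Γ`. -/
noncomputable def L.lift [Finite V] {L' : Type*} [LieRing L'] [LieAlgebra ℤ L'] (x : V → L')
    (hx : ∀ i j, ⁅Artin.vertex Γ i, Artin.vertex Γ j⁆ = 1 → ⁅x i, x j⁆ = 0) : L Γ →ₗ⁅ℤ⁆ L' :=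
  (toL Γ).descend (toL_surjective Γ) (FreeLieAlgebra.lift ℤ x)
    fun _ => lift_eq_zero_of_toL_eq_zero x hx

theorem L.lift_vertex [Finite V] {L' : Type*} [LieRing L'] [LieAlgebra ℤ L'] (x : V → L')
    (hx : ∀ i j, ⁅Artin.vertex Γ i, Artin.vertex Γ j⁆ = 1 → ⁅x i, x j⁆ = 0) (i : V) :
    L.lift Γ x hx (L.vertex Γ i) = x i := by
  rw [← toL_of]
  exact (LieHom.descend_apply _ _ _ _ _).trans (FreeLieAlgebra.lift_of_apply x i)

end PartiallyCommutative

/-- `L_Γ`, with its vertices, is the free partially commutative Lie algebra on `Γ`. -/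
theorem theorem4 {V : Type*} [Finite V] (Γ : SimpleGraph V) :
    (∀ i j : V, ⁅PartiallyCommutative.Artin.vertex Γ i, PartiallyCommutative.Artin.vertex Γ j⁆ = 1 →
      ⁅PartiallyCommutative.L.vertex Γ i, PartiallyCommutative.L.vertex Γ j⁆ = 0) ∧
    ∀ (L : Type*) [LieRing L] [LieAlgebra ℤ L] (x : V → L),
      (∀ i j : V,
        ⁅PartiallyCommutative.Artin.vertex Γ i, PartiallyCommutative.Artin.vertex Γ j⁆ = 1 →
          ⁅x i, x j⁆ = 0) →
      ∃! ψ : PartiallyCommutative.L Γ →ₗ⁅ℤ⁆ L,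
        ∀ i : V, ψ (PartiallyCommutative.L.vertex Γ i) = x i := by
  refine ⟨fun i j h => PartiallyCommutative.lie_vertex_eq_zero Γ h, fun L _ _ x hx =>
    ⟨PartiallyCommutative.L.lift Γ x hx, PartiallyCommutative.L.lift_vertex Γ x hx, ?_⟩⟩
  intro ψ hψ
  have h : ψ.comp (PartiallyCommutative.toL Γ) =
      (PartiallyCommutative.L.lift Γ x hx).comp (PartiallyCommutative.toL Γ) := by
    refine FreeLieAlgebra.hom_ext fun i => ?_
    change ψ (PartiallyCommutative.toL Γ (FreeLieAlgebra.of ℤ i)) =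
      PartiallyCommutative.L.lift Γ x hx (PartiallyCommutative.toL Γ (FreeLieAlgebra.of ℤ i))
    rw [PartiallyCommutative.toL_of, hψ, PartiallyCommutative.L.lift_vertex]
  refine LieHom.ext fun u => ?_
  obtain ⟨f, rfl⟩ := PartiallyCommutative.toL_surjective Γ u
  exact LieHom.congr_fun h f
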